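/- Let $n>1$, $\tau\in\mathbb C$ with $\operatorname{Im}\tau>0$, and $c,u\in\mathbb C$. For $m,l$ put $\theta_{m,l}(v,\tau)=\sum_{\mu\in m+l\mathbb Z}\exp 2\pi i\bigl(\mu v+\tfrac{\mu^2}{2l}\tau\bigr)$, and let $\theta(v)=\theta_{1/2,1}(v+\tfrac12,\tau)$ (the odd Jacobi theta function), $\theta_j(v)=\theta_{n/2-j,\,n}(v+\tfrac12,\tau)$ for $1\le j\le n$, and $\eta(\tau)$ the Dedekind eta function. Let $\mathfrak h^*=\{\lambda\in\mathbb C^n:\sum_i\lambda_i=0\}$ with the restriction of the bilinear form $\langle\epsilon_i,\epsilon_j\rangle=\delta_{ij}$ of $\mathbb C^n$, let $\bar\epsilon_i=\epsilon_i-\frac1n\sum_k\epsilon_k$, and $\lambda_{i,j}=\langle\lambda,\bar\epsilon_i-\bar\epsilon_j\rangle$. Write $\partial/\partial\bar\epsilon_i$ for the derivative in the direction $\bar\epsilon_i$. For $\lambda\in\mathfrak h^*$ let $\phi(u)_{\lambda,j}^{k}=\theta_j\bigl(\tfrac un-\langle\lambda,\bar\epsilon_k\rangle\bigr)/(\sqrt{-1}\,\eta(\tau))$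 (the $j$-th component of the intertwining vector for the step $\lambda\to\lambda+\hbar\bar\epsilon_k$), and let $[\bar\phi(u)_\lambda^{k,j}]_{k,j}$ be the inverse of the matrix $[\phi(u)_{\lambda,j}^{k}]_{j,k}$. The difference operators $$(L(c|u)^i_jf)(\lambda)=\sum_{k=1}^n\phi(u+c\hbar)_{\lambda,j}^{k}\,\bar\phi(u)_\lambda^{k,i}\,f(\lambda+\hbar\bar\epsilon_k)$$ form the factorized $L$-operator, and $$\tilde L(c|u)^{i'}_{j'}=\sum_{i,j=1}^n\bar\phi(u)_\lambda^{j',j}\,\phi(u)_{\lambda,i}^{i'}\,L(c|u)^i_j$$ is its conjugate by the matrix of intertwining vectors. Let $\Delta(\lambda)=\prod_{i<j}\theta(\lambda_{i,j})$. Assume $\theta(u)\ne0$. Let $U\subset\mathfrak h^*$ be an open set on which $\Delta$ has no zero and which carries a continuous branch of $\log\Delta$; use this branch to define $\Delta^{\pm c/n}$ on $U$. Then for all $i,j\in\{1,\dots,n\}$, acting on holomorphic functions on $U$, the derivative $\left.\frac{\partial}{\partial\hbar}\tilde L(c|u)^i_j\right|_{\hbar=0}$ of the operator composed with $\Delta^{c/n}$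 exists and $$\frac{\prod_{k\ne j}\theta(\lambda_{k,j})}{\prod_{k\ne i}\theta(\lambda_{k,i})}\cdot \Delta^{-c/n}\circ\left.\frac{\partial}{\partial\hbar}\tilde L(c|u)^i_j\right|_{\hbar=0}\circ\Delta^{c/n} =K(c|u)^i_j,$$ where $$K(c|u)^i_j=\delta^i_j\left\{\frac cn\frac{\theta'(u)}{\theta(u)}+\frac{\partial}{\partial\bar\epsilon_j}\right\} +(1-\delta^i_j)\,\frac cn\,\frac{\theta(u+\lambda_{j,i})\,\theta'(0)}{\theta(u)\,\theta(\lambda_{j,i})}.$$ Moreover $K(c|u)$ is Krichever's Lax matrix of the elliptic Calogero–Moser system up to a diagonal gauge transformation and the addition of a scalar matrix: let $\sigma(v)=e^{hv^2}\theta(v)/\theta'(0)$, $h=-2\pi i\frac{d}{d\tau}\log\eta(\tau)$, be the Weierstrass sigma function with periods $1,\tau$, let $\zeta=\sigma'/\sigma$ and $\Phi(s,u)=\frac{\sigma(u-s)}{\sigma(u)\sigma(s)}e^{\zeta(u)s}$. Then with $a=\theta'(u)/\theta(u)$, $$e^{a\langle\lambda,\bar\epsilon_i\rangle}\circ K(c|u)^i_j\circ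 e^{-a\langle\lambda,\bar\epsilon_j\rangle} =\left\{\delta^i_j\frac{\partial}{\partial\bar\epsilon_i}-(1-\delta^i_j)\frac cn\,\Phi(\lambda_{i,j},u)\right\} +\delta^i_j\Bigl(\frac cn-1+\frac1n\Bigr)a .$$ -/

import Mathlib

noncomputable section

namespace EllipticLax

open Complex

/-- `θ_{m,l}(u,τ) = ∑_{μ ∈ m + lℤ} exp 2πi(μ u + μ² τ / (2l))`. -/
def thetaChar (m l u τ : ℂ) : ℂ :=
  ∑' k : ℤ, exp (2 * Real.pi * I * ((m + l * k) * u + (m + l * k) ^ 2 / (2 * l) * τ))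

/-- The odd Jacobi theta function `θ(u) = θ_{1/2,1}(u + 1/2, τ)`. -/
def theta (τ u : ℂ) : ℂ := thetaChar (1 / 2) 1 (u + 1 / 2) τ

/-- `θ_j(u) = θ_{n/2-j,n}(u + 1/2, τ)` for `j = 1, …, n`; the index `j : Fin n` stands for the
integer `j + 1`. -/
def thetaVec (n : ℕ) (τ : ℂ) (j : Fin n) (u : ℂ) : ℂ :=
  thetaChar ((n : ℂ) / 2 - ((j : ℕ) + 1)) n (u + 1 / 2) τ

/-- The weight space `𝔥*` of `sl_n(ℂ)`: the orthogonal complement of `∑ᵢ εᵢ` in `ℂⁿ` for the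
bilinear form with `⟨εᵢ, εⱼ⟩ = δᵢⱼ`. -/
def WeightSpace (n : ℕ) : Submodule ℂ (Fin n → ℂ) where
  carrier := {x | x ⬝ᵥ 1 = 0}
  add_mem' := by
    intro a b ha hb
    simp only [Set.mem_ofPred_eq] at *
    rw [add_dotProduct, ha, hb, add_zero]
  zero_mem' := by simp
  smul_mem' := by
    intro t a ha
    simp only [Set.mem_ofPred_eq] at *
    rw [smul_dotProduct, ha, smul_zero]

/-- The orthogonal projection `ε̄ᵢ = εᵢ - (1/n) ∑ₖ εₖ` of `εᵢ` to the weight space. -/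
def epsBar {n : ℕ} (i : Fin n) : WeightSpace n :=
  ⟨Pi.single i 1 - (1 / (n : ℂ)) • 1, by
    have hn : (n : ℂ) ≠ 0 := by
      have := i.pos
      exact_mod_cast this.ne'
    change (Pi.single i 1 - (1 / (n : ℂ)) • (1 : Fin n → ℂ)) ⬝ᵥ 1 = 0
    rw [sub_dotProduct, smul_dotProduct]
    simp [hn]⟩

/-- The bilinear pairing `⟨x, y⟩` on the weight space. -/
def pairing {n : ℕ} (x y : WeightSpace n) : ℂ := (x : Fin n → ℂ) ⬝ᵥ (y : Fin n → ℂ)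

/-- `x_{i,j} = ⟨x, ε̄ᵢ - ε̄ⱼ⟩`. -/
def coordDiff {n : ℕ} (x : WeightSpace n) (i j : Fin n) : ℂ :=
  pairing x (epsBar i - epsBar j)

/-- Operators on functions on the weight space. -/
abbrev FunOp (n : ℕ) : Type := (WeightSpace n → ℂ) → (WeightSpace n → ℂ)

/-- The outgoing intertwining vectors: the `(j, k)` entry is the `j`-th component
`θ_j(u/n - ⟨x, ε̄ₖ⟩) / (√-1 η(τ))` of the vector attached to the arrow from `x` to `x + ħ ε̄ₖ`.
The arrow is recorded by its direction `k`; the value does not involve `ħ`. -/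
def outVec {n : ℕ} (τ u : ℂ) (x : WeightSpace n) : Matrix (Fin n) (Fin n) ℂ :=
  Matrix.of fun j k =>
    thetaVec n τ j (u / n - pairing x (epsBar k)) / (I * ModularForm.eta τ)

/-- The incoming intertwining vectors: the inverse of the matrix of outgoing ones. The `(k, j)` entry
is the `j`-th component of the vector attached to the arrow from `x` to `x + ħ ε̄ₖ`. -/
def inVec {n : ℕ} (τ u : ℂ) (x : WeightSpace n) : Matrix (Fin n) (Fin n) ℂ :=
  (outVec τ u x)⁻¹

/-- The factorized difference L-operator `L(c|u)^i_j`. -/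
def lOp {n : ℕ} (τ ħ c u : ℂ) (i j : Fin n) : FunOp n := fun f x =>
  ∑ k : Fin n, outVec τ (u + c * ħ) x j k * inVec τ u x k i * f (x + ħ • epsBar k)

/-- The conjugated L-operator `L̃(c|u)^{i'}_{j'}`. -/
def lTilde {n : ℕ} (τ ħ c u : ℂ) (i' j' : Fin n) : FunOp n := fun f x =>
  ∑ i : Fin n, ∑ j : Fin n, inVec τ u x j' j * outVec τ u x i i' * lOp τ ħ c u i j f x

/-- The `ħ`-derivative at `ħ = 0` of `L̃(c|u)^i_j`. -/
def lTildeDeriv {n : ℕ} (τ c u : ℂ) (i j : Fin n) : FunOp n := fun f x =>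
  deriv (fun ħ : ℂ => lTilde τ ħ c u i j f x) 0

/-- `Δ(x) = ∏_{i<j} θ(x_{i,j})`. -/
def thetaDelta {n : ℕ} (τ : ℂ) (x : WeightSpace n) : ℂ :=
  ∏ i : Fin n, ∏ j ∈ Finset.Ioi i, theta τ (coordDiff x i j)

/-- `∏_{k ≠ i} θ(x_{k,i})`. -/
def gaugeProd {n : ℕ} (τ : ℂ) (x : WeightSpace n) (i : Fin n) : ℂ :=
  ∏ k ∈ Finset.univ.erase i, theta τ (coordDiff x k i)

/-- `ℓ` is a (continuous, hence holomorphic) branch of `log Δ` on `U`. -/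
def IsLogDeltaBranch {n : ℕ} (τ : ℂ) (ℓ : WeightSpace n → ℂ) (U : Set (WeightSpace n)) : Prop :=
  ContinuousOn ℓ U ∧ ∀ x ∈ U, exp (ℓ x) = thetaDelta τ x

/-- Multiplication by the branch `Δ^s = exp (s ℓ)` of the power of `Δ`. -/
def mulDeltaPow {n : ℕ} (ℓ : WeightSpace n → ℂ) (s : ℂ) : FunOp n := fun f x =>
  exp (s * ℓ x) * f x

/-- The matrix of differential operators `K(c|u)^i_j`; `∂/∂ε̄ⱼ` is the derivative in the
direction `ε̄ⱼ`. -/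
def laxK {n : ℕ} (τ c u : ℂ) (i j : Fin n) : FunOp n := fun f x =>
  if i = j then
    c / n * (deriv (theta τ) u / theta τ u) * f x + lineDeriv ℂ f x (epsBar j)
  else
    c / n * (theta τ (u + coordDiff x j i) * deriv (theta τ) 0 /
      (theta τ u * theta τ (coordDiff x j i))) * f x

/-- The Weierstrass sigma function with periods `1, τ`, in its classical expression
`σ(u) = exp(h u²) θ(u) / θ'(0)`, `h = -2πi (d/dτ) log η(τ)`. -/
def wSigma (τ u : ℂ) : ℂ :=
  exp (-2 * Real.pi * I * logDeriv ModularForm.eta τ * u ^ 2) * theta τ u / deriv (theta τ) 0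

/-- The Lamé function `Φ(s, u) = σ(u - s) / (σ(u) σ(s)) · exp(ζ(u) s)`, where `ζ = σ'/σ`. -/
def lamePhi (τ s u : ℂ) : ℂ :=
  wSigma τ (u - s) / (wSigma τ u * wSigma τ s) * exp (logDeriv (wSigma τ) u * s)

/-- Krichever's Lax matrix of the elliptic Calogero–Moser system with coupling `g`, spectral
parameter `u` and momenta `∂/∂ε̄ᵢ`: the entries are `δᵢⱼ ∂/∂ε̄ᵢ + (1 - δᵢⱼ) g Φ(x_{i,j}, u)`. -/
def kricheverLax {n : ℕ} (τ g u : ℂ) (i j : Fin n) : FunOp n := fun f x =>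
  if i = j then lineDeriv ℂ f x (epsBar i) else g * lamePhi τ (coordDiff x i j) u * f x

/-- Multiplication by `exp (a ⟨x, ε̄ᵢ⟩)`. -/
def mulExp {n : ℕ} (a : ℂ) (i : Fin n) : FunOp n := fun f x =>
  exp (a * pairing x (epsBar i)) * f x

end EllipticLax

end

namespace EllipticLax

open Complex

/-! The heart of the proof is a closed form for `inVec τ u x * outVec τ v x`. Put z_k = u/n - ⟨λ,
ε̄_k⟩, so that ∑ z_k = u. The function θ(u + w - z_j) ∏_{k ≠ j} θ(w - z_k) has the degree and
character of the θ_l, hence lies in their span (`exists_interpolation`), and it vanishes at z_i for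
i ≠ j. After normalisation these Lagrange interpolants give a left inverse of `outVec τ u x`; their
values at v/n - ⟨λ, ε̄_i⟩ give `inVec_mul_outVec`, with no determinant to evaluate.

The sum defining L̃ then collapses to a single shift with a theta quotient as coefficient
(`lTilde_apply`). Off the diagonal the quotient contains θ(cħ/n), and only the derivative of this
factor survives at ħ = 0. On the diagonal it equals 1 at ħ = 0 and contributes its logarithmic
derivative; the part (c/n) ∑_{k ≠ i} (θ'/θ)(λ_{k,i}) is -(c/n) ∂ log Δ/∂ε̄_i, which conjugation by
Δ^{c/n} cancels.

For Krichever's matrix, the Gaussian factors of σ cancel in Φ against the linear term of ζ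
(`lamePhi_eq`); the remaining exponential is the diagonal gauge. -/

/-! ### Theta functions of degree p as Fourier series -/

/-- `f` is a theta function of degree `p` and character `exp (2πi b)`: it has a Fourier expansion
over `p / 2 + ℤ` whose coefficients satisfy the recurrence that expresses quasi-periodicity in the
direction `τ`. -/
def HasThetaExpansion (τ : ℂ) (p : ℕ) (b : ℂ) (f : ℂ → ℂ) : Prop :=
  ∃ c : ℤ → ℂ, (∀ w, HasSum (fun m : ℤ => c m * exp (2 * Real.pi * I * ((m + p / 2) * w))) (f w)) ∧
    ∀ m : ℤ, c (m + p) = c m * exp (2 * Real.pi * I * (b + (m + p / 2) * τ + p / 2 * τ))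

theorem hasThetaExpansion_one (τ : ℂ) : HasThetaExpansion τ 0 0 (fun _ => 1) := by
  refine ⟨fun m => if m = 0 then 1 else 0, fun w => ?_, fun m => ?_⟩
  · convert hasSum_ite_eq (0 : ℤ) (1 : ℂ) using 2 with m
    split_ifs with h <;> simp [h]
  · by_cases h : m = 0 <;> simp [h]

theorem hasSum_mul_sub {f g : ℤ → ℂ} {a b : ℂ} (hf : HasSum f a) (hg : HasSum g b) :
    HasSum (fun x : ℤ × ℤ => f (x.1 - x.2) * g x.2) (a * b) := by
  let e : ℤ × ℤ ≃ ℤ × ℤ :=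
    { toFun := fun x => (x.1 - x.2, x.2)
      invFun := fun x => (x.1 + x.2, x.2)
      left_inv := fun x => by simp
      right_inv := fun x => by simp }
  exact e.hasSum_iff.mpr
    (hf.mul hg (summable_mul_of_summable_norm hf.summable.norm hg.summable.norm))

theorem HasThetaExpansion.mul {τ : ℂ} {p q : ℕ} {a b : ℂ} {f g : ℂ → ℂ}
    (hf : HasThetaExpansion τ p a f) (hg : HasThetaExpansion τ q b g) :
    HasThetaExpansion τ (p + q) (a + b) (fun w => f w * g w) := by
  obtain ⟨c, hc, hcr⟩ := hf
  obtain ⟨d, hd, hdr⟩ := hg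
  have key : ∀ w, HasSum (fun x : ℤ × ℤ => c (x.1 - x.2) * d x.2 *
      exp (2 * Real.pi * I * ((x.1 + (p + q : ℕ) / 2) * w))) (f w * g w) := by
    intro w
    convert hasSum_mul_sub (hc w) (hd w) using 2 with x
    rw [mul_mul_mul_comm (c _), ← exp_add]
    congr 2
    push_cast
    ring
  -- At w = 0 the exponentials are 1, so the double series gives the convergence of every
  -- convolution coefficient.
  have hfib : ∀ m : ℤ, Summable fun k : ℤ => c (m - k) * d k := by
    intro m
    have h := (key 0).summable.prod_factor m
    simpa using h
  refine ⟨fun m => ∑' k : ℤ, c (m - k) * d k, fun w => ?_, fun m => ?_⟩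
  · refine (key w).prod_fiberwise fun m => ?_
    exact (hfib m).hasSum.mul_right _
  · dsimp only
    rw [← tsum_mul_right,
      ← (Equiv.addRight (q : ℤ)).tsum_eq fun k => c (m + ((p + q : ℕ) : ℤ) - k) * d k]
    refine tsum_congr fun k => ?_
    simp only [Equiv.coe_addRight]
    have h1 : m + ((p + q : ℕ) : ℤ) - (k + q) = m - k + p := by push_cast; ring
    rw [h1, hcr, hdr, mul_mul_mul_comm, ← exp_add]
    congr 2
    push_cast
    ring

theorem HasThetaExpansion.prod {ι : Type*} {τ : ℂ} {b : ι → ℂ} {f : ι → ℂ → ℂ} (s : Finset ι)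
    (h : ∀ k ∈ s, HasThetaExpansion τ 1 (b k) (f k)) :
    HasThetaExpansion τ s.card (∑ k ∈ s, b k) (fun w => ∏ k ∈ s, f k w) := by
  classical
  induction s using Finset.induction_on with
  | empty => simpa using hasThetaExpansion_one τ
  | insert k s hk ih =>
    have := (h k (Finset.mem_insert_self k s)).mul
      (ih fun l hl => h l (Finset.mem_insert_of_mem hl))
    simp only [Finset.sum_insert hk, Finset.prod_insert hk, Finset.card_insert_of_notMem hk]
    rwa [add_comm s.card 1]

/-- A theta function of degree `n` with the character of the `θ_j` is a linear combination
of them. -/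
theorem HasThetaExpansion.exists_eq_sum_thetaVec {τ : ℂ} {n : ℕ} (hn : n ≠ 0) {f : ℂ → ℂ}
    (h : HasThetaExpansion τ n (n / 2) f) :
    ∃ b : Fin n → ℂ, ∀ w, f w = ∑ j, b j * thetaVec n τ j w := by
  obtain ⟨c, hc, hcr⟩ := h
  have : NeZero n := ⟨hn⟩
  have hn' : (n : ℂ) ≠ 0 := by exact_mod_cast hn
  -- `E` collects the Fourier coefficients of all the θ_j and obeys the recurrence of `c`, so `c /
  -- E` is n-periodic.
  set E : ℤ → ℂ := fun m =>
    exp (2 * Real.pi * I * ((m + n / 2) / 2 + (m + n / 2) ^ 2 / (2 * n) * τ)) with hE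
  set d : ℤ → ℂ := fun m => c m / E m with hd
  have hper : Function.Periodic d (n : ℤ) := by
    intro m
    have : E (m + n) = E m * exp (2 * Real.pi * I * (n / 2 + (m + n / 2) * τ + n / 2 * τ)) := by
      simp only [hE]
      rw [← exp_add]
      congr 1
      push_cast
      field_simp
      ring
    simp only [hd]
    rw [hcr, this, mul_div_mul_right _ _ (exp_ne_zero _)]
  have hcd : ∀ m, c m = d m * E m := fun m => by
    simp only [hd]
    rw [div_mul_cancel₀ _ (exp_ne_zero _)]
  -- The frequencies of θ_j are those with m ≡ -(j + 1) mod n; division with remainder is reflected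
  -- accordingly.
  let e : Fin n × ℤ ≃ ℤ :=
    (((Equiv.prodComm _ _).trans ((Equiv.neg ℤ).prodCongr (Equiv.refl _))).trans
      (Int.divModEquiv n).symm).trans (Equiv.subLeft (-1))
  have he : ∀ j k, e (j, k) = -((j : ℕ) + 1 : ℤ) + k * n := by
    intro j k
    simp [e, Int.divModEquiv]
    ring
  refine ⟨fun j => d (-((j : ℕ) + 1 : ℤ)), fun w => ?_⟩
  have hterm : ∀ x : Fin n × ℤ, c (e x) * exp (2 * Real.pi * I * ((e x + n / 2) * w)) =
      d (-((x.1 : ℕ) + 1 : ℤ)) * exp (2 * Real.pi * I *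
        (((n : ℂ) / 2 - ((x.1 : ℕ) + 1) + n * x.2) * (w + 1 / 2) +
          ((n : ℂ) / 2 - ((x.1 : ℕ) + 1) + n * x.2) ^ 2 / (2 * n) * τ)) := by
    rintro ⟨j, k⟩
    have hdk : d (-((j : ℕ) + 1 : ℤ) + k * n) = d (-((j : ℕ) + 1 : ℤ)) := by
      simpa using hper.int_mul k (-((j : ℕ) + 1 : ℤ))
    rw [hcd, he, hdk, mul_assoc, hE]
    dsimp only
    rw [← exp_add]
    congr 2
    push_cast
    ring
  have h1 := (e.hasSum_iff.mpr (hc w))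
  simp only [Function.comp_def, hterm] at h1
  have h2 := h1.prod_fiberwise fun j => (h1.summable.prod_factor j).hasSum
  rw [h2.unique (hasSum_fintype _)]
  simp only [tsum_mul_left, thetaVec, thetaChar]

/-! ### The odd theta function -/

theorem hasSum_theta {τ : ℂ} (hτ : 0 < τ.im) (u : ℂ) :
    HasSum (fun k : ℤ => exp (2 * Real.pi * I *
      ((1 / 2 + k) * (u + 1 / 2) + (1 / 2 + k) ^ 2 / 2 * τ))) (theta τ u) ∧
    theta τ u = exp (2 * Real.pi * I * (1 / 2 * (u + 1 / 2) + τ / 8)) *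
      jacobiTheta₂ (u + 1 / 2 + τ / 2) τ := by
  have h := (hasSum_jacobiTheta₂_term (u + 1 / 2 + τ / 2) hτ).mul_left
    (exp (2 * Real.pi * I * (1 / 2 * (u + 1 / 2) + τ / 8)))
  have h2 : (fun k : ℤ => exp (2 * Real.pi * I * (1 / 2 * (u + 1 / 2) + τ / 8)) *
      jacobiTheta₂_term k (u + 1 / 2 + τ / 2) τ) = fun k : ℤ => exp (2 * Real.pi * I *
      ((1 / 2 + k) * (u + 1 / 2) + (1 / 2 + k) ^ 2 / 2 * τ)) := by
    funext k
    rw [jacobiTheta₂_term, ← exp_add]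
    congr 1
    ring
  rw [h2] at h
  have h3 : theta τ u = exp (2 * Real.pi * I * (1 / 2 * (u + 1 / 2) + τ / 8)) *
      jacobiTheta₂ (u + 1 / 2 + τ / 2) τ := by
    rw [← h.tsum_eq]
    simp [theta, thetaChar]
  exact ⟨h3 ▸ h, h3⟩

theorem hasThetaExpansion_theta {τ : ℂ} (hτ : 0 < τ.im) (a : ℂ) :
    HasThetaExpansion τ 1 (1 / 2 - a) (fun w => theta τ (w - a)) := by
  refine ⟨fun k => exp (2 * Real.pi * I *
      ((1 / 2 + k) * (1 / 2 - a) + (1 / 2 + k) ^ 2 / 2 * τ)), fun w => ?_, fun m => ?_⟩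
  · convert (hasSum_theta hτ (w - a)).1 using 2 with k
    rw [← exp_add]
    congr 1
    push_cast
    ring
  · dsimp only
    rw [← exp_add]
    congr 1
    push_cast
    ring

theorem differentiable_theta {τ : ℂ} (hτ : 0 < τ.im) : Differentiable ℂ (theta τ) := by
  have h : theta τ = fun u => exp (2 * Real.pi * I * (1 / 2 * (u + 1 / 2) + τ / 8)) *
      jacobiTheta₂ (u + 1 / 2 + τ / 2) τ := funext fun u => (hasSum_theta hτ u).2
  have hJ : Differentiable ℂ fun z => jacobiTheta₂ z τ :=
    fun z => differentiableAt_jacobiTheta₂_fst z hτ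
  rw [h]
  refine Differentiable.mul (by fun_prop) ?_
  exact hJ.comp (by fun_prop : Differentiable ℂ fun u : ℂ => u + 1 / 2 + τ / 2)

theorem theta_neg (τ u : ℂ) : theta τ (-u) = -theta τ u := by
  simp only [theta, thetaChar]
  -- k ↦ -1 - k sends μ = k + 1/2 to -μ; the shift by 1/2 in the argument then costs exp(2πiμ) = -1.
  rw [← tsum_neg, ← (Equiv.subLeft (-1 : ℤ)).tsum_eq]
  refine tsum_congr fun k => ?_
  rw [← neg_one_mul (exp _), ← exp_pi_mul_I, ← exp_add, exp_eq_exp_iff_exists_int]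
  refine ⟨-k - 1, ?_⟩
  simp only [Equiv.subLeft_apply]
  push_cast
  ring

theorem theta_zero (τ : ℂ) : theta τ 0 = 0 := by
  have h := theta_neg τ 0
  rw [neg_zero] at h
  exact self_eq_neg.mp h

theorem logDeriv_theta_neg (τ u : ℂ) : logDeriv (theta τ) (-u) = -logDeriv (theta τ) u := by
  have h : deriv (theta τ) (-u) = deriv (theta τ) u := by
    have h1 := deriv_comp_neg (theta τ) u
    simp only [theta_neg, deriv.fun_neg] at h1
    exact (neg_injective h1).symm
  rw [logDeriv_apply, logDeriv_apply, h, theta_neg, div_neg]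

/-! ### Coordinates on the weight space -/

theorem pairing_epsBar {n : ℕ} (x : WeightSpace n) (i : Fin n) :
    pairing x (epsBar i) = (x : Fin n → ℂ) i := by
  have h : (x : Fin n → ℂ) ⬝ᵥ 1 = 0 := x.2
  simp only [pairing, epsBar]
  rw [dotProduct_sub, dotProduct_smul, h]
  simp

theorem sum_pairing_epsBar {n : ℕ} (x : WeightSpace n) : ∑ i, pairing x (epsBar i) = 0 := by
  have h : (x : Fin n → ℂ) ⬝ᵥ 1 = 0 := x.2
  simpa [pairing_epsBar, dotProduct] using h

theorem coordDiff_eq {n : ℕ} (x : WeightSpace n) (i j : Fin n) :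
    coordDiff x i j = pairing x (epsBar i) - pairing x (epsBar j) := by
  simp only [coordDiff, pairing]
  exact dotProduct_sub _ _ _

theorem coordDiff_swap {n : ℕ} (x : WeightSpace n) (i j : Fin n) :
    coordDiff x i j = -coordDiff x j i := by
  rw [coordDiff_eq, coordDiff_eq, neg_sub]

theorem pairing_add_smul {n : ℕ} (x y z : WeightSpace n) (t : ℂ) :
    pairing (x + t • y) z = pairing x z + t * pairing y z := by
  change ((x : Fin n → ℂ) + t • (y : Fin n → ℂ)) ⬝ᵥ (z : Fin n → ℂ) = _
  rw [add_dotProduct, smul_dotProduct]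
  rfl

theorem pairing_epsBar_epsBar {n : ℕ} (i j : Fin n) :
    pairing (epsBar i) (epsBar j) = (if i = j then 1 else 0) - 1 / (n : ℂ) := by
  rw [pairing_epsBar]
  simp [epsBar, Pi.single_apply, eq_comm]

theorem coordDiff_add_smul_epsBar {n : ℕ} (x : WeightSpace n) (t : ℂ) (i k l : Fin n) :
    coordDiff (x + t • epsBar i) k l =
      coordDiff x k l + t * ((if i = k then 1 else 0) - if i = l then 1 else 0) := by
  simp only [coordDiff_eq, pairing_add_smul, pairing_epsBar_epsBar]
  ring

theorem theta_coordDiff_ne_zero {n : ℕ} {τ : ℂ} {x : WeightSpace n} (h : thetaDelta τ x ≠ 0)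
    {i j : Fin n} (hij : i ≠ j) : theta τ (coordDiff x i j) ≠ 0 := by
  have hlt : ∀ k l : Fin n, k < l → theta τ (coordDiff x k l) ≠ 0 := fun k l hkl =>
    Finset.prod_ne_zero_iff.mp (Finset.prod_ne_zero_iff.mp h k (Finset.mem_univ k)) l
      (Finset.mem_Ioi.mpr hkl)
  rcases lt_or_gt_of_ne hij with h1 | h1
  · exact hlt i j h1
  · rw [coordDiff_swap, theta_neg]
    exact neg_ne_zero.mpr (hlt j i h1)

theorem gaugeProd_ne_zero {n : ℕ} {τ : ℂ} {x : WeightSpace n} (h : thetaDelta τ x ≠ 0)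
    (i : Fin n) : gaugeProd τ x i ≠ 0 :=
  Finset.prod_ne_zero_iff.mpr fun _ hk => theta_coordDiff_ne_zero h (Finset.ne_of_mem_erase hk)

/-! ### Interpolation and products of intertwining vectors -/

/-- The interpolation functions `w ↦ θ(u + w - z_j) ∏_{k ≠ j} θ(w - z_k)`, where `∑ z_k = u`, are
linear combinations of the `θ_l`. -/
theorem exists_interpolation {n : ℕ} {τ : ℂ} (hτ : 0 < τ.im) {u : ℂ} (z : Fin n → ℂ)
    (hz : ∑ k, z k = u) (j : Fin n) :
    ∃ b : Fin n → ℂ, ∀ w, theta τ (u + w - z j) * ∏ k ∈ Finset.univ.erase j, theta τ (w - z k) =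
      ∑ l, b l * thetaVec n τ l w := by
  -- Moving the j-th zero by u makes the zeros sum to 0, so the character is exactly n/2.
  have h := HasThetaExpansion.prod (τ := τ) (Finset.univ : Finset (Fin n))
    (b := fun k => 1 / 2 - (z k - if k = j then u else 0))
    (f := fun k w => theta τ (w - (z k - if k = j then u else 0)))
    fun k _ => hasThetaExpansion_theta hτ _
  have hb : ∑ k, (1 / 2 - (z k - if k = j then u else 0)) = (n : ℂ) / 2 := by
    simp only [Finset.sum_sub_distrib, hz]
    simp
    ring
  rw [hb, Finset.card_univ, Fintype.card_fin] at h
  obtain ⟨b, hb⟩ := h.exists_eq_sum_thetaVec j.pos.ne'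
  refine ⟨b, fun w => ?_⟩
  rw [← hb, ← Finset.mul_prod_erase _ _ (Finset.mem_univ j)]
  congr 1
  · congr 1
    simp
    ring
  · refine Finset.prod_congr rfl fun k hk => ?_
    simp [Finset.ne_of_mem_erase hk]

/-- For j ≠ i the factor k = i is θ(0) = 0. The term (u - u)/n is kept to match the general formula
at v = u. -/
theorem interpolation_quotient_self {n : ℕ} {τ u : ℂ} (hu : theta τ u ≠ 0)
    {x : WeightSpace n} (hx : thetaDelta τ x ≠ 0) (j i : Fin n) :
    theta τ (u + (u - u) / n + coordDiff x j i) *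
        (∏ k ∈ Finset.univ.erase j, theta τ (coordDiff x k i + (u - u) / n)) /
        (theta τ u * gaugeProd τ x j) = (1 : Matrix (Fin n) (Fin n) ℂ) j i := by
  have hself : ∀ i, coordDiff x i i = 0 := fun i => by rw [coordDiff_eq, sub_self]
  by_cases hji : j = i
  · subst hji
    simp only [hself, sub_self, zero_div, add_zero, Matrix.one_apply_eq]
    exact div_self (mul_ne_zero hu (gaugeProd_ne_zero hx j))
  · rw [Matrix.one_apply_ne hji, Finset.prod_eq_zero
      (Finset.mem_erase.mpr ⟨Ne.symm hji, Finset.mem_univ i⟩)]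
    · simp
    · simp [hself, theta_zero]

/-- The product of the incoming and the outgoing intertwining vectors with different spectral
parameters. -/
theorem inVec_mul_outVec {n : ℕ} {τ : ℂ} (hτ : 0 < τ.im) {u : ℂ} (hu : theta τ u ≠ 0)
    {x : WeightSpace n} (hx : thetaDelta τ x ≠ 0) (v : ℂ) (j i : Fin n) :
    (inVec τ u x * outVec τ v x) j i =
      theta τ (u + (v - u) / n + coordDiff x j i) *
        (∏ k ∈ Finset.univ.erase j, theta τ (coordDiff x k i + (v - u) / n)) /
        (theta τ u * gaugeProd τ x j) := by
  have hn : (n : ℂ) ≠ 0 := by exact_mod_cast i.pos.ne'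
  have hη : I * ModularForm.eta τ ≠ 0 := mul_ne_zero I_ne_zero (ModularForm.eta_ne_zero hτ)
  set z : Fin n → ℂ := fun k => u / n - pairing x (epsBar k) with hz
  have hzs : ∑ k, z k = u := by
    simp only [hz, Finset.sum_sub_distrib, sum_pairing_epsBar]
    simp
    field_simp
  choose b hb using exists_interpolation hτ z hzs
  have hprod : ∀ (w : ℂ) (j i : Fin n), (Matrix.of b * outVec τ w x) j i =
      theta τ (u + (w - u) / n + coordDiff x j i) *
        (∏ k ∈ Finset.univ.erase j, theta τ (coordDiff x k i + (w - u) / n)) /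
          (I * ModularForm.eta τ) := by
    intro w j i
    have h1 : (Matrix.of b * outVec τ w x) j i =
        (∑ l, b j l * thetaVec n τ l (w / n - pairing x (epsBar i))) / (I * ModularForm.eta τ) := by
      simp [Matrix.mul_apply, outVec, Finset.sum_div, mul_div_assoc]
    rw [h1, ← hb]
    congr 2
    · congr 1
      simp only [hz, coordDiff_eq]
      ring
    · refine Finset.prod_congr rfl fun k _ => ?_
      congr 1
      simp only [hz, coordDiff_eq]
      ring
  set B : Matrix (Fin n) (Fin n) ℂ :=
    Matrix.diagonal (fun j => I * ModularForm.eta τ / (theta τ u * gaugeProd τ x j)) * Matrix.of b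
    with hB
  have hBmul : ∀ (w : ℂ) (j i : Fin n), (B * outVec τ w x) j i =
      theta τ (u + (w - u) / n + coordDiff x j i) *
        (∏ k ∈ Finset.univ.erase j, theta τ (coordDiff x k i + (w - u) / n)) /
        (theta τ u * gaugeProd τ x j) := by
    intro w j i
    rw [hB, Matrix.mul_assoc, Matrix.diagonal_mul, hprod, div_mul_div_comm,
      mul_comm (I * ModularForm.eta τ), mul_div_mul_right _ _ hη]
  have hinv : B * outVec τ u x = 1 := by
    ext j i
    rw [hBmul, interpolation_quotient_self hu hx]
  rw [inVec, Matrix.inv_eq_left_inv hinv, hBmul]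

theorem inVec_mul_outVec_self {n : ℕ} {τ : ℂ} (hτ : 0 < τ.im) {u : ℂ} (hu : theta τ u ≠ 0)
    {x : WeightSpace n} (hx : thetaDelta τ x ≠ 0) : inVec τ u x * outVec τ u x = 1 := by
  ext j i
  rw [inVec_mul_outVec hτ hu hx, interpolation_quotient_self hu hx]

/-- The conjugated L-operator in closed form. -/
theorem lTilde_apply {n : ℕ} {τ : ℂ} (hτ : 0 < τ.im) {u : ℂ} (hu : theta τ u ≠ 0)
    {x : WeightSpace n} (hx : thetaDelta τ x ≠ 0) (ħ c : ℂ) (i j : Fin n) (f : WeightSpace n → ℂ) :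
    lTilde τ ħ c u i j f x =
      theta τ (u + coordDiff x j i + c / n * ħ) *
        (∏ k ∈ Finset.univ.erase j, theta τ (coordDiff x k i + c / n * ħ)) /
        (theta τ u * gaugeProd τ x j) * f (x + ħ • epsBar i) := by
  -- The sums regroup into two matrix products, the second of which is the identity, so only k = i
  -- survives.
  have h1 : lTilde τ ħ c u i j f x = ∑ k, (inVec τ u x * outVec τ (u + c * ħ) x) j k *
      (inVec τ u x * outVec τ u x) k i * f (x + ħ • epsBar k) := by
    simp only [lTilde, lOp, Matrix.mul_apply, Finset.mul_sum, Finset.sum_mul]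
    rw [Finset.sum_comm]
    conv_lhs => enter [2, b]; rw [Finset.sum_comm]
    rw [Finset.sum_comm]
    refine Finset.sum_congr rfl fun k _ => ?_
    rw [Finset.sum_comm]
    refine Finset.sum_congr rfl fun a _ => Finset.sum_congr rfl fun b _ => ?_
    ring
  rw [h1, inVec_mul_outVec_self hτ hu hx, Finset.sum_eq_single i]
  · rw [inVec_mul_outVec hτ hu hx, Matrix.one_apply_eq, mul_one]
    have h2 : (u + c * ħ - u) / n = c / n * ħ := by ring
    rw [h2, add_right_comm]
  · intro k _ hk
    rw [Matrix.one_apply_ne hk, mul_zero, zero_mul]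
  · simp

/-! ### Derivatives at ħ = 0 -/

theorem hasDerivAt_finsetProd_of_ne_zero {ι : Type*} {s : Finset ι} {f : ι → ℂ → ℂ} {f' : ι → ℂ}
    {t : ℂ} (hf : ∀ k ∈ s, HasDerivAt (f k) (f' k) t) (h0 : ∀ k ∈ s, f k t ≠ 0) :
    HasDerivAt (fun y => ∏ k ∈ s, f k y) ((∏ k ∈ s, f k t) * ∑ k ∈ s, f' k / f k t) t := by
  classical
  refine (HasDerivAt.fun_finsetProd hf).congr_deriv ?_
  rw [Finset.mul_sum]
  refine Finset.sum_congr rfl fun k hk => ?_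
  have := h0 k hk
  rw [← Finset.mul_prod_erase s _ hk, smul_eq_mul]
  field_simp

/-- A continuous logarithm of a differentiable function is differentiable. -/
theorem hasDerivAt_of_exp_eventuallyEq {g h : ℂ → ℂ} {h' t : ℂ} (hg : ContinuousAt g t)
    (hh : HasDerivAt h h' t) (heq : ∀ᶠ y in nhds t, exp (g y) = h y) :
    HasDerivAt g (h' / h t) t := by
  have ht : exp (g t) = h t := heq.self_of_nhds
  have h0 : h t ≠ 0 := ht ▸ exp_ne_zero _
  have hsub : ContinuousAt (fun y => (g y - g t).im) t :=
    (continuous_im.continuousAt).comp (hg.sub continuousAt_const)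
  have hlt : ∀ᶠ y in nhds t, |(g y - g t).im| < Real.pi := by
    refine hsub.abs.eventually_lt continuousAt_const ?_
    simpa using Real.pi_pos
  -- By continuity g y - g t stays in the strip |Im| < π, where the principal logarithm inverts exp.
  have hlog : g =ᶠ[nhds t] fun y => g t + log (h y / h t) := by
    filter_upwards [heq, hlt] with y hy hy'
    rw [← hy, ← ht, ← exp_sub, log_exp (abs_lt.mp hy').1 (abs_lt.mp hy').2.le]
    ring
  refine HasDerivAt.congr_of_eventuallyEq ?_ hlog
  have h1 := (hh.div_const (h t)).clog (by rw [div_self h0]; exact one_mem_slitPlane)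
  rw [div_self h0, div_one] at h1
  exact h1.const_add (g t)

theorem hasDerivAt_theta_affine {τ : ℂ} (hτ : 0 < τ.im) (a b : ℂ) :
    HasDerivAt (fun t => theta τ (a + b * t)) (deriv (theta τ) a * b) 0 := by
  have h1 : HasDerivAt (fun t : ℂ => a + b * t) b 0 := by
    simpa using ((hasDerivAt_id (0 : ℂ)).const_mul b).const_add a
  have h2 : HasDerivAt (theta τ) (deriv (theta τ) a) (a + b * 0) := by
    simpa using ((differentiable_theta hτ) a).hasDerivAt
  exact h2.comp 0 h1

theorem hasDerivAt_prod_theta_affine {ι : Type*} {τ : ℂ} (hτ : 0 < τ.im) (s : Finset ι)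
    (a b : ι → ℂ) (h0 : ∀ k ∈ s, theta τ (a k) ≠ 0) :
    HasDerivAt (fun t => ∏ k ∈ s, theta τ (a k + b k * t))
      ((∏ k ∈ s, theta τ (a k)) * ∑ k ∈ s, logDeriv (theta τ) (a k) * b k) 0 := by
  have h := hasDerivAt_finsetProd_of_ne_zero (s := s) (t := 0)
    (fun k _ => hasDerivAt_theta_affine hτ (a k) (b k)) (by simpa using h0)
  simp only [mul_zero, add_zero] at h
  convert h using 2
  refine Finset.sum_congr rfl fun k _ => ?_
  rw [logDeriv_apply]
  ring

/-- Only the factors involving the index i vary, at rate ±1; oddness of θ'/θ gives both kinds the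
same sign. -/
theorem hasDerivAt_thetaDelta {n : ℕ} {τ : ℂ} (hτ : 0 < τ.im) {x : WeightSpace n}
    (hx : thetaDelta τ x ≠ 0) (i : Fin n) :
    HasDerivAt (fun t : ℂ => thetaDelta τ (x + t • epsBar i))
      (thetaDelta τ x *
        -∑ k ∈ Finset.univ.erase i, logDeriv (theta τ) (coordDiff x k i)) 0 := by
  have h := hasDerivAt_prod_theta_affine hτ
    (Finset.univ.sigma fun k : Fin n => Finset.Ioi k) (fun p => coordDiff x p.1 p.2)
    (fun p => (if i = p.1 then 1 else 0) - if i = p.2 then 1 else 0) (by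
      rintro ⟨k, l⟩ hp
      simp only [Finset.mem_sigma, Finset.mem_Ioi] at hp
      exact theta_coordDiff_ne_zero hx hp.2.ne)
  simp only [Finset.prod_sigma, Finset.sum_sigma] at h
  have hfun : (fun t : ℂ => thetaDelta τ (x + t • epsBar i)) = fun t : ℂ =>
      ∏ k : Fin n, ∏ l ∈ Finset.Ioi k, theta τ (coordDiff x k l +
        ((if i = k then 1 else 0) - if i = l then 1 else 0) * t) := by
    funext t
    simp only [thetaDelta, coordDiff_add_smul_epsBar, mul_comm t]
  rw [hfun]
  refine h.congr_deriv (congrArg (thetaDelta τ x * ·) ?_)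
  have hodd : ∀ k, logDeriv (theta τ) (coordDiff x k i) =
      -logDeriv (theta τ) (coordDiff x i k) := fun k => by
    rw [coordDiff_swap, logDeriv_theta_neg]
  have herase : Finset.univ.erase i = Finset.Ioi i ∪ Finset.Iio i := by
    ext k
    simp only [Finset.mem_erase, Finset.mem_univ, Finset.mem_union, Finset.mem_Ioi,
      Finset.mem_Iio, and_true]
    rw [ne_iff_lt_or_gt, or_comm]
  have hdisj : Disjoint (Finset.Ioi i) (Finset.Iio i) := by
    rw [Finset.disjoint_left]
    intro k h1 h2
    exact lt_asymm (Finset.mem_Ioi.mp h1) (Finset.mem_Iio.mp h2)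
  rw [herase, Finset.sum_union hdisj]
  simp only [mul_sub, mul_ite, mul_one, mul_zero, Finset.sum_sub_distrib]
  have h1 : ∑ k : Fin n, ∑ l ∈ Finset.Ioi k,
      (if i = k then logDeriv (theta τ) (coordDiff x k l) else 0) =
      ∑ l ∈ Finset.Ioi i, logDeriv (theta τ) (coordDiff x i l) := by
    rw [Finset.sum_eq_single i]
    · simp
    · intro k _ hk
      simp [Ne.symm hk]
    · simp
  have h2 : ∑ k : Fin n, ∑ l ∈ Finset.Ioi k,
      (if i = l then logDeriv (theta τ) (coordDiff x k l) else 0) =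
      ∑ k ∈ Finset.Iio i, logDeriv (theta τ) (coordDiff x k i) := by
    simp only [Finset.sum_ite_eq, Finset.mem_Ioi]
    rw [← Finset.sum_filter]
    congr 1
    ext k
    simp
  rw [h1, h2, Finset.sum_congr (s₁ := Finset.Ioi i) rfl fun k _ => hodd k, Finset.sum_neg_distrib]
  ring

theorem hasDerivAt_lineMap {n : ℕ} (x v : WeightSpace n) :
    HasDerivAt (fun t : ℂ => x + t • v) v 0 := by
  simpa using ((hasDerivAt_id (0 : ℂ)).smul_const v).const_add x

theorem hasDerivAt_comp_line {n : ℕ} {f : WeightSpace n → ℂ} {x : WeightSpace n}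
    (hf : DifferentiableAt ℂ f x) (v : WeightSpace n) :
    HasDerivAt (fun t : ℂ => f (x + t • v)) (lineDeriv ℂ f x v) 0 := by
  have := hf.lineDifferentiableAt (v := v)
  exact this.hasLineDerivAt

theorem hasDerivAt_mulDeltaPow {n : ℕ} {τ : ℂ} (hτ : 0 < τ.im) {U : Set (WeightSpace n)}
    (hU : IsOpen U) {ℓ : WeightSpace n → ℂ} (hℓ : IsLogDeltaBranch τ ℓ U) (s : ℂ)
    {f : WeightSpace n → ℂ} {x : WeightSpace n} (hf : DifferentiableAt ℂ f x) (hx : x ∈ U)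
    (i : Fin n) :
    HasDerivAt (fun t : ℂ => mulDeltaPow ℓ s f (x + t • epsBar i))
      (exp (s * ℓ x) * (lineDeriv ℂ f x (epsBar i) -
        s * (∑ k ∈ Finset.univ.erase i, logDeriv (theta τ) (coordDiff x k i)) * f x)) 0 := by
  have hΔ : thetaDelta τ x ≠ 0 := hℓ.2 x hx ▸ exp_ne_zero _
  have hline : ContinuousAt (fun t : ℂ => x + t • epsBar i) 0 :=
    (hasDerivAt_lineMap x (epsBar i)).continuousAt
  have hUx : U ∈ nhds (x + (0 : ℂ) • epsBar i) := by simpa using hU.mem_nhds hx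
  have hg : ContinuousAt (fun t : ℂ => ℓ (x + t • epsBar i)) 0 :=
    ContinuousAt.comp (g := ℓ) (hℓ.1.continuousAt hUx) hline
  have hlog := hasDerivAt_of_exp_eventuallyEq hg (hasDerivAt_thetaDelta hτ hΔ i)
    ((hline.eventually hUx).mono fun t ht => hℓ.2 _ ht)
  simp only [zero_smul, add_zero] at hlog
  rw [mul_div_cancel_left₀ _ hΔ] at hlog
  have h := (hlog.const_mul s).cexp.mul (hasDerivAt_comp_line hf (epsBar i))
  simp only [zero_smul, add_zero] at h
  refine h.congr_deriv ?_
  ring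

theorem hasDerivAt_lTilde_diag {n : ℕ} {τ : ℂ} (hτ : 0 < τ.im) {u : ℂ} (hu : theta τ u ≠ 0)
    {x : WeightSpace n} (hx : thetaDelta τ x ≠ 0) (c : ℂ) (i : Fin n) {F : WeightSpace n → ℂ}
    {F' : ℂ} (hF : HasDerivAt (fun t : ℂ => F (x + t • epsBar i)) F' 0) :
    HasDerivAt (fun ħ : ℂ => lTilde τ ħ c u i i F x)
      (c / n * (logDeriv (theta τ) u +
        ∑ k ∈ Finset.univ.erase i, logDeriv (theta τ) (coordDiff x k i)) * F x + F') 0 := by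
  have hD : theta τ u * gaugeProd τ x i ≠ 0 := mul_ne_zero hu (gaugeProd_ne_zero hx i)
  have hfun : (fun ħ : ℂ => lTilde τ ħ c u i i F x) = fun ħ : ℂ => theta τ (u + c / n * ħ) *
        (∏ k ∈ Finset.univ.erase i, theta τ (coordDiff x k i + c / n * ħ)) /
        (theta τ u * gaugeProd τ x i) * F (x + ħ • epsBar i) := by
    funext ħ
    rw [lTilde_apply hτ hu hx, coordDiff_eq x i i, sub_self, add_zero]
  rw [hfun]
  have h := (((hasDerivAt_theta_affine hτ u (c / n)).mul
    (hasDerivAt_prod_theta_affine hτ (Finset.univ.erase i) (fun k => coordDiff x k i)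
      (fun _ => c / n) fun k hk => theta_coordDiff_ne_zero hx (Finset.ne_of_mem_erase hk))).div_const
    (theta τ u * gaugeProd τ x i)).mul hF
  simp only [mul_zero, add_zero, zero_smul, Pi.mul_apply] at h
  refine h.congr_deriv ?_
  change (_ * gaugeProd τ x i + _ * (gaugeProd τ x i * _)) / _ * _ +
    theta τ u * gaugeProd τ x i / _ * _ = _
  rw [div_self hD, one_mul, ← Finset.sum_mul, logDeriv_apply (theta τ) u]
  have := gaugeProd_ne_zero hx i
  congr 1
  generalize ∑ k ∈ Finset.univ.erase i, logDeriv (theta τ) (coordDiff x k i) = S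
  generalize c / (n : ℂ) = q
  field_simp

/-- The factor k = i is θ(cħ/n), which vanishes at ħ = 0, so the derivative of `F` never enters. -/
theorem hasDerivAt_lTilde_offDiag {n : ℕ} {τ : ℂ} (hτ : 0 < τ.im) {u : ℂ} (hu : theta τ u ≠ 0)
    {x : WeightSpace n} (hx : thetaDelta τ x ≠ 0) (c : ℂ) {i j : Fin n} (hij : i ≠ j)
    {F : WeightSpace n → ℂ} (hF : DifferentiableAt ℂ (fun t : ℂ => F (x + t • epsBar i)) 0) :
    HasDerivAt (fun ħ : ℂ => lTilde τ ħ c u i j F x)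
      (gaugeProd τ x i / gaugeProd τ x j * (c / n * (theta τ (u + coordDiff x j i) *
        deriv (theta τ) 0 / (theta τ u * theta τ (coordDiff x j i))) * F x)) 0 := by
  have hi : i ∈ Finset.univ.erase j := Finset.mem_erase.mpr ⟨hij, Finset.mem_univ i⟩
  have hj : j ∈ Finset.univ.erase i := Finset.mem_erase.mpr ⟨hij.symm, Finset.mem_univ j⟩
  set P : ℂ → ℂ := fun ħ =>
    ∏ k ∈ (Finset.univ.erase j).erase i, theta τ (coordDiff x k i + c / n * ħ) with hP
  have hfun : (fun ħ : ℂ => lTilde τ ħ c u i j F x) = fun ħ : ℂ => theta τ (0 + c / n * ħ) *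
        (theta τ (u + coordDiff x j i + c / n * ħ) * P ħ /
        (theta τ u * gaugeProd τ x j) * F (x + ħ • epsBar i)) := by
    funext ħ
    rw [lTilde_apply hτ hu hx, ← Finset.mul_prod_erase _ _ hi, coordDiff_eq x i i, sub_self]
    ring
  have hPd : DifferentiableAt ℂ P 0 := by
    refine (hasDerivAt_prod_theta_affine hτ _ (fun k => coordDiff x k i)
      (fun _ => c / n) fun k hk => ?_).differentiableAt
    exact theta_coordDiff_ne_zero hx (Finset.ne_of_mem_erase hk)
  have hq := ((((hasDerivAt_theta_affine hτ (u + coordDiff x j i) (c / n)).differentiableAt.mul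
    hPd).div_const (theta τ u * gaugeProd τ x j)).mul hF).hasDerivAt
  have h := (hasDerivAt_theta_affine hτ 0 (c / n)).mul hq
  rw [hfun]
  refine h.congr_deriv ?_
  have hg : gaugeProd τ x i = theta τ (coordDiff x j i) * P 0 := by
    rw [gaugeProd, ← Finset.mul_prod_erase _ _ hj, Finset.erase_right_comm, hP]
    simp
  have h0 := theta_coordDiff_ne_zero hx hij.symm
  have h1 := gaugeProd_ne_zero hx j
  simp only [mul_zero, add_zero, zero_smul, Pi.mul_apply, theta_zero, zero_mul]
  rw [hg]
  generalize c / (n : ℂ) = q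
  field_simp

/-! ### Comparison with Krichever's Lax matrix -/

theorem logDeriv_wSigma {τ : ℂ} (hτ : 0 < τ.im) (h0 : deriv (theta τ) 0 ≠ 0) {u : ℂ}
    (hu : theta τ u ≠ 0) :
    logDeriv (wSigma τ) u =
      2 * (-2 * Real.pi * I * logDeriv ModularForm.eta τ) * u + logDeriv (theta τ) u := by
  set η' : ℂ := -2 * Real.pi * I * logDeriv ModularForm.eta τ with hη'
  have h1 : HasDerivAt (fun v : ℂ => η' * v ^ 2) (η' * (2 * u)) u := by
    simpa using (hasDerivAt_pow 2 u).const_mul η'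
  have h2 : HasDerivAt (wSigma τ) _ u :=
    (h1.cexp.mul ((differentiable_theta hτ) u).hasDerivAt).div_const (deriv (theta τ) 0)
  rw [logDeriv_apply, h2.deriv, logDeriv_apply, wSigma, ← hη']
  have := exp_ne_zero (η' * u ^ 2)
  field_simp

theorem lamePhi_eq {τ : ℂ} (hτ : 0 < τ.im) {u : ℂ} (hu : theta τ u ≠ 0) (s : ℂ) :
    lamePhi τ s u = exp (logDeriv (theta τ) u * s) *
      (theta τ (u - s) * deriv (theta τ) 0 / (theta τ u * theta τ s)) := by
  -- If θ'(0) were 0, both sides would be 0, since division by zero gives 0.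
  by_cases h0 : deriv (theta τ) 0 = 0
  · simp [lamePhi, wSigma, h0]
  rw [lamePhi, logDeriv_wSigma hτ h0 hu]
  simp only [wSigma]
  set η' : ℂ := -2 * Real.pi * I * logDeriv ModularForm.eta τ
  have hexp : exp (η' * (u - s) ^ 2) * exp ((2 * η' * u + logDeriv (theta τ) u) * s) =
      exp (η' * u ^ 2) * exp (η' * s ^ 2) * exp (logDeriv (theta τ) u * s) := by
    rw [← exp_add, ← exp_add, ← exp_add]
    congr 1
    ring
  have e1 := exp_ne_zero (η' * u ^ 2)
  have e2 := exp_ne_zero (η' * s ^ 2)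
  generalize exp (η' * u ^ 2) = A at *
  generalize exp (η' * s ^ 2) = B at *
  generalize exp (η' * (u - s) ^ 2) = C at *
  generalize exp ((2 * η' * u + logDeriv (theta τ) u) * s) = D at *
  generalize exp (logDeriv (theta τ) u * s) = E at *
  by_cases hs : theta τ s = 0
  · simp [hs]
  field_simp
  linear_combination theta τ (u - s) * hexp

/-- The constant 1 - 1/n is ⟨ε̄_i, ε̄_i⟩, the source of -1 + 1/n in the scalar term. -/
theorem lineDeriv_mulExp {n : ℕ} (a : ℂ) (i : Fin n) {f : WeightSpace n → ℂ} {x : WeightSpace n}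
    (hf : DifferentiableAt ℂ f x) :
    lineDeriv ℂ (mulExp a i f) x (epsBar i) = exp (a * pairing x (epsBar i)) *
      (lineDeriv ℂ f x (epsBar i) + a * (1 - 1 / n) * f x) := by
  have h1 : HasDerivAt (fun t : ℂ => a * pairing (x + t • epsBar i) (epsBar i))
      (a * (1 - 1 / n)) 0 := by
    simp only [pairing_add_smul, pairing_epsBar_epsBar, if_true]
    simpa using (((hasDerivAt_id (0 : ℂ)).mul_const (1 - 1 / (n : ℂ))).const_add
      (pairing x (epsBar i))).const_mul a
  have h := h1.cexp.mul (hasDerivAt_comp_line hf (epsBar i))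
  simp only [zero_smul, add_zero] at h
  rw [lineDeriv]
  refine h.deriv.trans ?_
  ring

theorem mulExp_laxK_mulExp {n : ℕ} {τ : ℂ} (hτ : 0 < τ.im) (c : ℂ) {u : ℂ}
    (hu : theta τ u ≠ 0) {f : WeightSpace n → ℂ} {x : WeightSpace n}
    (hf : DifferentiableAt ℂ f x) (i j : Fin n) :
    mulExp (logDeriv (theta τ) u) i
        (laxK τ c u i j (mulExp (-logDeriv (theta τ) u) j f)) x =
      kricheverLax τ (-(c / n)) u i j f x +
        (if i = j then (c / n - (1 - 1 / n)) * logDeriv (theta τ) u * f x else 0) := by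
  by_cases hij : i = j
  · subst hij
    simp only [mulExp, laxK, kricheverLax, if_true]
    have h := lineDeriv_mulExp (-logDeriv (theta τ) u) i hf
    rw [h, ← logDeriv_apply]
    have hexp : exp (logDeriv (theta τ) u * pairing x (epsBar i)) *
        exp (-logDeriv (theta τ) u * pairing x (epsBar i)) = 1 := by
      rw [← exp_add, neg_mul, add_neg_cancel, exp_zero]
    linear_combination (c / n * logDeriv (theta τ) u * f x + lineDeriv ℂ f x (epsBar i)
      - logDeriv (theta τ) u * (1 - 1 / n) * f x) * hexp
  · simp only [mulExp, laxK, kricheverLax, if_neg hij, add_zero]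
    rw [lamePhi_eq hτ hu, coordDiff_swap x j i, theta_neg, ← sub_eq_add_neg]
    have hexp : exp (logDeriv (theta τ) u * coordDiff x i j) =
        exp (logDeriv (theta τ) u * pairing x (epsBar i)) *
        exp (-logDeriv (theta τ) u * pairing x (epsBar j)) := by
      rw [← exp_add, coordDiff_eq]
      congr 1
      ring
    rw [hexp, mul_neg, div_neg]
    ring

/-! ### Assembly -/

theorem gaugeProd_mul_mulDeltaPow_lTildeDeriv {n : ℕ} {τ : ℂ} (hτ : 0 < τ.im) (c : ℂ) {u : ℂ}
    (hu : theta τ u ≠ 0) {U : Set (WeightSpace n)} (hU : IsOpen U) {ℓ : WeightSpace n → ℂ}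
    (hℓ : IsLogDeltaBranch τ ℓ U) {f : WeightSpace n → ℂ} {x : WeightSpace n}
    (hf : DifferentiableAt ℂ f x) (hx : x ∈ U) (i j : Fin n) :
    DifferentiableAt ℂ (fun ħ : ℂ => lTilde τ ħ c u i j (mulDeltaPow ℓ (c / n) f) x) 0 ∧
      gaugeProd τ x j / gaugeProd τ x i * mulDeltaPow ℓ (-(c / n))
        (lTildeDeriv τ c u i j (mulDeltaPow ℓ (c / n) f)) x = laxK τ c u i j f x := by
  have hΔ : thetaDelta τ x ≠ 0 := hℓ.2 x hx ▸ exp_ne_zero _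
  have hF := hasDerivAt_mulDeltaPow hτ hU hℓ (c / n) hf hx i
  have hexp : exp (-(c / n) * ℓ x) * exp (c / n * ℓ x) = 1 := by
    rw [← exp_add, neg_mul, neg_add_cancel, exp_zero]
  have hgi := gaugeProd_ne_zero hΔ i
  have hgj := gaugeProd_ne_zero hΔ j
  by_cases hij : i = j
  · subst hij
    have h := hasDerivAt_lTilde_diag hτ hu hΔ c i hF
    refine ⟨h.differentiableAt, ?_⟩
    simp only [mulDeltaPow, lTildeDeriv, laxK, if_true] at h ⊢
    rw [h.deriv, div_self hgi, one_mul, ← logDeriv_apply]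
    linear_combination (c / n * logDeriv (theta τ) u * f x + lineDeriv ℂ f x (epsBar i)) * hexp
  · have h := hasDerivAt_lTilde_offDiag hτ hu hΔ c hij hF.differentiableAt
    refine ⟨h.differentiableAt, ?_⟩
    simp only [mulDeltaPow, lTildeDeriv, laxK, if_neg hij] at h ⊢
    rw [h.deriv]
    have hg : gaugeProd τ x j / gaugeProd τ x i * (gaugeProd τ x i / gaugeProd τ x j) = 1 := by
      field_simp
    generalize theta τ (u + coordDiff x j i) * deriv (theta τ) 0 /
      (theta τ u * theta τ (coordDiff x j i)) = K
    linear_combination (c / n * K * f x) * hexp +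
      (exp (-(c / n) * ℓ x) * exp (c / n * ℓ x) * (c / n * K * f x)) * hg

end EllipticLax

theorem proposition3 (n : ℕ) (hn : 1 < n) (τ : ℂ) (hτ : 0 < τ.im) (c u : ℂ)
    (hu : EllipticLax.theta τ u ≠ 0)
    (U : Set (EllipticLax.WeightSpace n)) (hU : IsOpen U)
    (ℓ : EllipticLax.WeightSpace n → ℂ) (hℓ : EllipticLax.IsLogDeltaBranch τ ℓ U)
    (f : EllipticLax.WeightSpace n → ℂ) (hf : DifferentiableOn ℂ f U)
    (x : EllipticLax.WeightSpace n) (hx : x ∈ U) (i j : Fin n) :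
    DifferentiableAt ℂ
        (fun ħ : ℂ => EllipticLax.lTilde τ ħ c u i j (EllipticLax.mulDeltaPow ℓ (c / n) f) x) 0 ∧
      EllipticLax.gaugeProd τ x j / EllipticLax.gaugeProd τ x i *
          EllipticLax.mulDeltaPow ℓ (-(c / n))
            (EllipticLax.lTildeDeriv τ c u i j (EllipticLax.mulDeltaPow ℓ (c / n) f)) x =
        EllipticLax.laxK τ c u i j f x ∧
      EllipticLax.mulExp (logDeriv (EllipticLax.theta τ) u) i
          (EllipticLax.laxK τ c u i j
            (EllipticLax.mulExp (-logDeriv (EllipticLax.theta τ) u) j f)) x =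
        EllipticLax.kricheverLax τ (-(c / n)) u i j f x +
          (if i = j then
            (c / n - (1 - 1 / n)) * logDeriv (EllipticLax.theta τ) u * f x else 0) := by

  have hfx : DifferentiableAt ℂ f x := (hf x hx).differentiableAt (hU.mem_nhds hx)
  obtain ⟨h1, h2⟩ :=
    EllipticLax.gaugeProd_mul_mulDeltaPow_lTildeDeriv hτ c hu hU hℓ hfx hx i j
  exact ⟨h1, h2, EllipticLax.mulExp_laxK_mulExp hτ c hu hfx i j⟩
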